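/- A graphing $G=(J,\mathcal B,E,\lambda)$ consists of a standard Borel space $(J,\mathcal B)$, a probability measure $\lambda$ on $\mathcal B$, and a symmetric Borel set $E\subseteq J\times J$ disjoint from the diagonal (the edge set), such that the degrees in the graph $(J,E)$ are bounded by a finite constant and $\int_A \deg_B\,d\lambda=\int_B\deg_A\,d\lambda$ for all $A,B\in\mathcal B$, where $\deg_B(x)$ is the number of edges from $x$ to $B$. Borel sets of edges are symmetric Borel subsets $X\subseteq E$; for each of them $(J,\mathcal B,X,\lambda)$ is again a graphing. Let $\overline d=\overline d_G=\int_J\deg\,d\lambda$ be the average degree, and let $\eta=\eta_G$ be the edge measure, that is, the Borel measure on $J\times J$ with $\eta(A\times B)=\frac1{\overline d}\int_A\deg_B\,d\lambda$ (with $\eta=0$ if $\overline d=0$). For a Borel set $X\subseteq E$ of edges let $X_u$ be the node set of the connected component of $u$ in $(J,X)$, and let $$\rho(X)=1-\int_J\frac1{|X_u|}\,d\lambda(u),\qquad \frac1\infty=0,$$ be the rank function of the cycle matroid of $G$. A graphing is hyperfinite if for every $\varepsilon>0$ there is a Borel set $X$ of its edges of edge measure less than $\varepsilon$ such that after deleting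 $X$ all connected components are finite. A spanning subforest of $G$ is a graph $H=(J,F)$ without cycles, where $F\subseteq E$ is a Borel set of edges, such that every connected component of $H$ either is infinite or has the same node set as a connected component of $G$. (In particular, this holds if $H$ is a maximal forest in $G$, i.e. if each connected component of $G$ is spanned by a single tree of $H$.) Corollary. Let $G=(J,\mathcal B,E,\lambda)$ be a graphing and let $H=(J,F)$ be a spanning subforest of $G$ such that the graphing $(J,\mathcal B,F,\lambda)$ is hyperfinite. Then $$\alpha(X)=\frac{\overline d}{2}\,\eta(X\cap F)$$ defines a measure on the Borel subsets of $E$ such that $\alpha(X)\le\rho(X)$ for every Borel set $X\subseteq E$ of edges, and $\alpha(E)=\rho(E)$; that is, $\alpha$ is a minorizing measure of $\rho$ with full total mass (a "basis" of the cycle matroid of $G$). -/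

import Mathlib

open MeasureTheory Set
open scoped ENNReal

noncomputable section

namespace GraphingMatroid

variable {J : Type*}

/-- The number of `y` with `(x, y) ∈ X`, i.e. the degree of `x` in the (symmetric) edge set `X`. -/
def deg (X : Set (J × J)) (x : J) : ℝ≥0∞ :=
  ((Prod.mk x ⁻¹' X).encard : ℝ≥0∞)

/-- The simple graph on `J` with edge set `X`; it is used for symmetric loopless `X`. -/
def toGraph (X : Set (J × J)) : SimpleGraph J :=
  SimpleGraph.fromRel fun x y => (x, y) ∈ X

/-- The node set of the connected component of `u` in the graph `(J, X)`. -/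
def component (X : Set (J × J)) (u : J) : Set J :=
  ((toGraph X).connectedComponentMk u).supp

theorem deg_iUnion (X : ℕ → Set (J × J)) (hd : Pairwise (Function.onFun Disjoint X)) (x : J) :
    deg (⋃ i, X i) x = ∑' i, deg (X i) x := by
  let _ : MeasurableSpace J := ⊤
  have h : ∀ Y : Set (J × J), deg Y x = Measure.count (Prod.mk x ⁻¹' Y) := fun Y =>
    (Measure.count_apply MeasurableSpace.measurableSet_top).symm
  simp only [h, preimage_iUnion]
  exact measure_iUnion (fun i j hij => (hd hij).preimage _) fun _ => MeasurableSpace.measurableSet_top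

theorem lintegral_deg_rect [MeasurableSpace J] (E : Set (J × J)) (A B : Set J)
    (hA : MeasurableSet A) (μ : Measure J) :
    ∫⁻ u, deg (A ×ˢ B ∩ E) u ∂μ = ∫⁻ u in A, deg (E ∩ univ ×ˢ B) u ∂μ := by
  rw [← lintegral_indicator hA]
  refine lintegral_congr fun u => ?_
  by_cases hu : u ∈ A
  · rw [indicator_of_mem hu]
    have : Prod.mk u ⁻¹' (A ×ˢ B ∩ E) = Prod.mk u ⁻¹' (E ∩ univ ×ˢ B) := by
      ext y
      simp [hu, and_comm]
    simp only [deg, this]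
  · rw [indicator_of_notMem hu]
    have : Prod.mk u ⁻¹' (A ×ˢ B ∩ E) = ∅ := by
      ext y
      simp [hu]
    simp [deg, this]

section Measurability

variable [MeasurableSpace J] [StandardBorelSpace J]

/-- In a Borel set with sections of bounded finite size, the section size is a Borel function. -/
theorem measurable_deg (D : ℕ) (X : Set (J × J)) (hX : MeasurableSet X)
    (hD : ∀ x, (Prod.mk x ⁻¹' X).encard ≤ D) : Measurable (deg X) := by
  classical
  induction D generalizing X with
  | zero =>
    have h : deg X = fun _ => 0 := by
      funext x
      have := hD x
      simp only [Nat.cast_zero, nonpos_iff_eq_zero] at this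
      simp [deg, this]
    rw [h]
    exact measurable_const
  | succ D ih =>
    let f : J → ℝ := embeddingReal J
    have hf : MeasurableEmbedding f := measurableEmbedding_embeddingReal J
    let P : Set (J × (Fin (D + 1) → J)) :=
      {p | (∀ i, (p.1, p.2 i) ∈ X) ∧ ∀ i j, i < j → f (p.2 i) < f (p.2 j)}
    have hP : MeasurableSet P := by
      have e : P = (⋂ i, {p : J × (Fin (D + 1) → J) | (p.1, p.2 i) ∈ X}) ∩
          ⋂ i, ⋂ j, {p : J × (Fin (D + 1) → J) | i < j → f (p.2 i) < f (p.2 j)} := by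
        ext p
        simp [P]
      rw [e]
      refine MeasurableSet.inter (MeasurableSet.iInter fun i => ?_)
        (MeasurableSet.iInter fun i => MeasurableSet.iInter fun j => ?_)
      · exact (show Measurable fun p : J × (Fin (D + 1) → J) => (p.1, p.2 i) by fun_prop) hX
      · by_cases hij : i < j
        · simp only [hij, forall_const]
          exact measurableSet_lt
            (hf.measurable.comp ((measurable_pi_apply i).comp measurable_snd))
            (hf.measurable.comp ((measurable_pi_apply j).comp measurable_snd))
        · simp [hij]
    have hrange : ∀ p ∈ P, range p.2 = Prod.mk p.1 ⁻¹' X ∧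
        (Prod.mk p.1 ⁻¹' X).encard = (D + 1 : ℕ) := by
      intro p hp
      have hinj : Function.Injective p.2 := by
        have hs : StrictMono (f ∘ p.2) := fun i j hij => hp.2 i j hij
        exact hs.injective.of_comp
      have hsub : range p.2 ⊆ Prod.mk p.1 ⁻¹' X := by
        rintro _ ⟨i, rfl⟩
        exact hp.1 i
      have hc : (range p.2).encard = (D + 1 : ℕ) := by
        rw [← image_univ, hinj.encard_image]
        simp
      have he : range p.2 = Prod.mk p.1 ⁻¹' X :=
        (finite_range p.2).eq_of_subset_of_encard_le hsub (by rw [hc]; exact hD p.1)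
      exact ⟨he, by rw [← he, hc]⟩
    have hPinj : InjOn Prod.fst P := by
      rintro ⟨x, y⟩ hp ⟨x', y'⟩ hp' (rfl : x = x')
      have hr : range y = range y' := (hrange _ hp).1.trans (hrange _ hp').1.symm
      have h1 : StrictMono (f ∘ y) := fun i j hij => hp.2 i j hij
      have h2 : StrictMono (f ∘ y') := fun i j hij => hp'.2 i j hij
      have h3 : f ∘ y = f ∘ y' := (StrictMono.range_inj h1 h2).1 (by rw [range_comp, range_comp, hr])
      have h4 : y = y' := funext fun i => hf.injective (congrFun h3 i)
      rw [h4]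
    have hS : MeasurableSet (Prod.fst '' P) := hP.image_of_measurable_injOn measurable_fst hPinj
    have hSiff : ∀ x, x ∉ Prod.fst '' P → (Prod.mk x ⁻¹' X).encard ≤ D := by
      intro x hx
      by_contra hlt
      have hfin : (Prod.mk x ⁻¹' X).Finite := finite_of_encard_le_coe (hD x)
      have hcard : (Prod.mk x ⁻¹' X).encard = (D + 1 : ℕ) := by
        refine le_antisymm (hD x) ?_
        push Not at hlt
        simpa using Order.add_one_le_of_lt hlt
      let T : Finset ℝ := hfin.toFinset.image f
      have hT : T.card = D + 1 := by
        rw [Finset.card_image_of_injective _ hf.injective]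
        rw [hfin.encard_eq_coe_toFinset_card] at hcard
        exact_mod_cast hcard
      have hmem : ∀ i, ∃ y, (x, y) ∈ X ∧ f y = T.orderEmbOfFin hT i := by
        intro i
        obtain ⟨y, hy, hfy⟩ := Finset.mem_image.1 (T.orderEmbOfFin_mem hT i)
        exact ⟨y, hfin.mem_toFinset.1 hy, hfy⟩
      choose y hy hfy using hmem
      refine hx ⟨(x, y), ⟨hy, fun i j hij => ?_⟩, rfl⟩
      simp only [hfy]
      exact (T.orderEmbOfFin hT).strictMono hij
    have key : deg X = (Prod.fst '' P).piecewise (fun _ => ((D + 1 : ℕ) : ℝ≥0∞))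
        (deg (X ∩ (Prod.fst ⁻¹' (Prod.fst '' P)ᶜ))) := by
      funext x
      by_cases hx : x ∈ Prod.fst '' P
      · rw [piecewise_eq_of_mem _ _ _ hx]
        obtain ⟨p, hp, rfl⟩ := hx
        simp only [deg, (hrange p hp).2]
        simp
      · rw [piecewise_eq_of_notMem _ _ _ hx]
        have : Prod.mk x ⁻¹' (X ∩ (Prod.fst ⁻¹' (Prod.fst '' P)ᶜ)) = Prod.mk x ⁻¹' X := by
          ext y
          constructor
          · exact fun h => h.1
          · exact fun h => ⟨h, hx⟩
        simp only [deg, this]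
    rw [key]
    refine Measurable.piecewise hS measurable_const (ih _ (hX.inter (measurable_fst hS.compl)) ?_)
    intro x
    by_cases hx : x ∈ Prod.fst '' P
    · have : Prod.mk x ⁻¹' (X ∩ (Prod.fst ⁻¹' (Prod.fst '' P)ᶜ)) = ∅ := by
        ext y
        constructor
        · exact fun h => h.2 hx
        · exact fun h => h.elim
      rw [this]
      simp
    · exact (encard_le_encard fun y h => h.1).trans (hSiff x hx)

end Measurability

/-- A graphing on a standard Borel space `J`: a symmetric loopless Borel edge set `E ⊆ J × J` with
bounded degrees and a Borel probability measure `μ` satisfying the measure-preservation equation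
`∫_A deg_B dμ = ∫_B deg_A dμ`, where `deg_B x` is the number of edges from `x` to `B`. -/
structure Graphing (J : Type*) [MeasurableSpace J] [StandardBorelSpace J] where
  E : Set (J × J)
  μ : Measure J
  isProbabilityMeasure : IsProbabilityMeasure μ
  measurableSet_E : MeasurableSet E
  symm : ∀ x y, (x, y) ∈ E → (y, x) ∈ E
  loopless : ∀ x, (x, x) ∉ E
  bounded : ∃ D : ℕ, ∀ x, (Prod.mk x ⁻¹' E).encard ≤ D
  preserving : ∀ A B : Set J, MeasurableSet A → MeasurableSet B →
    ∫⁻ x in A, deg (E ∩ univ ×ˢ B) x ∂μ = ∫⁻ x in B, deg (E ∩ univ ×ˢ A) x ∂μ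

namespace Graphing

variable [MeasurableSpace J] [StandardBorelSpace J] (G : Graphing J)

/-- A Borel set of (undirected) edges of `G`, as a symmetric Borel subset of `E`. -/
structure IsEdgeSet (X : Set (J × J)) : Prop where
  measurableSet : MeasurableSet X
  symm : ∀ x y, (x, y) ∈ X → (y, x) ∈ X
  subset : X ⊆ G.E

theorem measurable_deg_inter {X : Set (J × J)} (hX : MeasurableSet X) :
    Measurable (deg (X ∩ G.E)) := by
  obtain ⟨D, hD⟩ := G.bounded
  exact measurable_deg D _ (hX.inter G.measurableSet_E) fun x =>
    (encard_le_encard fun y h => h.2).trans (hD x)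

/-- The average degree. -/
def avgDeg : ℝ≥0∞ := ∫⁻ u, deg G.E u ∂G.μ

/-- The unnormalized edge measure `X ↦ ∫ deg_{X ∩ E} dμ`. -/
def preEdgeMeasure : Measure (J × J) :=
  Measure.ofMeasurable (fun X _ => ∫⁻ u, deg (X ∩ G.E) u ∂G.μ) (by simp [deg]) (by
    intro X hX hd
    have h : ∀ u, deg ((⋃ i, X i) ∩ G.E) u = ∑' i, deg (X i ∩ G.E) u := fun u => by
      rw [iUnion_inter]
      exact deg_iUnion _ (fun i j hij => (hd hij).mono inter_subset_left inter_subset_left) u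
    simp only [h]
    exact lintegral_tsum fun i => (G.measurable_deg_inter (hX i)).aemeasurable)

theorem preEdgeMeasure_apply {X : Set (J × J)} (hX : MeasurableSet X) :
    G.preEdgeMeasure X = ∫⁻ u, deg (X ∩ G.E) u ∂G.μ :=
  Measure.ofMeasurable_apply X hX

/-- The edge measure `η`: `η(X) = (1 / d̄) ∫ deg_X dμ` for Borel `X ⊆ E`, and `η` is supported
on `E`. (It is the zero measure in the degenerate case `d̄ = 0`.) -/
def edgeMeasure : Measure (J × J) := G.avgDeg⁻¹ • G.preEdgeMeasure

/-- `η` is the extension of `η(A × B) = (1 / d̄) ∫_A deg_B dμ`. -/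
theorem edgeMeasure_prod {A B : Set J} (hA : MeasurableSet A) (hB : MeasurableSet B) :
    G.edgeMeasure (A ×ˢ B) = G.avgDeg⁻¹ * ∫⁻ u in A, deg (G.E ∩ univ ×ˢ B) u ∂G.μ := by
  rw [edgeMeasure, Measure.smul_apply, G.preEdgeMeasure_apply (hA.prod hB),
    lintegral_deg_rect _ _ _ hA, smul_eq_mul]

theorem avgDeg_ne_top : G.avgDeg ≠ ∞ := by
  obtain ⟨D, hD⟩ := G.bounded
  have := G.isProbabilityMeasure
  refine ne_top_of_le_ne_top (ENNReal.natCast_ne_top D) ?_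
  calc G.avgDeg ≤ ∫⁻ _, (D : ℝ≥0∞) ∂G.μ := lintegral_mono fun u => by
        have h := ENat.toENNReal_mono (hD u)
        simpa [deg] using h
    _ = D := by simp

theorem preEdgeMeasure_univ : G.preEdgeMeasure univ = G.avgDeg := by
  rw [G.preEdgeMeasure_apply MeasurableSet.univ, univ_inter, avgDeg]

theorem isProbabilityMeasure_edgeMeasure (h : G.avgDeg ≠ 0) :
    IsProbabilityMeasure G.edgeMeasure :=
  ⟨by rw [edgeMeasure, Measure.smul_apply, preEdgeMeasure_univ, smul_eq_mul,
    ENNReal.inv_mul_cancel h G.avgDeg_ne_top]⟩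

theorem preEdgeMeasure_swap : G.preEdgeMeasure.map Prod.swap = G.preEdgeMeasure := by
  have : IsFiniteMeasure G.preEdgeMeasure :=
    ⟨by rw [preEdgeMeasure_univ]; exact G.avgDeg_ne_top.lt_top⟩
  refine Measure.ext_prod fun {A} {B} hA hB => ?_
  rw [Measure.map_apply measurable_swap (hA.prod hB), preimage_swap_prod,
    G.preEdgeMeasure_apply (hB.prod hA), G.preEdgeMeasure_apply (hA.prod hB),
    lintegral_deg_rect _ _ _ hA, lintegral_deg_rect _ _ _ hB, G.preserving B A hB hA]

/-- The subgraphing `(J, X, μ)` of `G` formed by a Borel edge set `X`. -/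
def sub (X : Set (J × J)) (hX : G.IsEdgeSet X) : Graphing J where
  E := X
  μ := G.μ
  isProbabilityMeasure := G.isProbabilityMeasure
  measurableSet_E := hX.measurableSet
  symm := hX.symm
  loopless x h := G.loopless x (hX.subset h)
  bounded := by
    obtain ⟨D, hD⟩ := G.bounded
    exact ⟨D, fun x => (encard_le_encard (preimage_mono hX.subset)).trans (hD x)⟩
  preserving A B hA hB := by
    have key : ∀ S T : Set J, MeasurableSet S → MeasurableSet T →
        ∫⁻ x in S, deg (X ∩ univ ×ˢ T) x ∂G.μ = G.preEdgeMeasure (S ×ˢ T ∩ X) := by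
      intro S T hS hT
      rw [← lintegral_deg_rect _ _ _ hS,
        G.preEdgeMeasure_apply ((hS.prod hT).inter hX.measurableSet), inter_assoc,
        inter_eq_left.2 hX.subset]
    rw [key A B hA hB, key B A hB hA]
    conv_lhs => rw [← G.preEdgeMeasure_swap]
    rw [Measure.map_apply measurable_swap ((hA.prod hB).inter hX.measurableSet)]
    congr 1
    ext ⟨x, y⟩
    simp only [mem_preimage, Prod.swap_prod_mk, mem_inter_iff, mem_prod]
    exact ⟨fun h => ⟨⟨h.1.2, h.1.1⟩, hX.symm _ _ h.2⟩, fun h => ⟨⟨h.1.2, h.1.1⟩, hX.symm _ _ h.2⟩⟩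

/-- The rank function of the cycle matroid of `G`: `ρ(X) = 1 - E (1 / |V(X_u)|)`, where `u` is a
random node, `X_u` is its component in `(J, X)`, and `1 / ∞ = 0`. -/
def rank (X : Set (J × J)) : ℝ≥0∞ :=
  1 - ∫⁻ u, ((component X u).encard : ℝ≥0∞)⁻¹ ∂G.μ

/-- `G` is hyperfinite if all components can be made finite by deleting a Borel edge set of
arbitrarily small edge measure. -/
def IsHyperfinite : Prop :=
  ∀ ε : ℝ≥0∞, 0 < ε → ∃ X, G.IsEdgeSet X ∧ G.edgeMeasure X < ε ∧
    ∀ u, (component (G.E \ X) u).Finite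

/-- A Borel forest `(J, F)` in `G` is spanning if each of its components is either the node set of a full component of `G`, or infinite. This covers maximal forests, whose
components have the same node sets as those of `G` (see `IsSpanningSubforest.of_reachable`), and
essential spanning forests, whose components inside infinite components of `G` are infinite. -/
structure IsSpanningSubforest (F : Set (J × J)) : Prop where
  isEdgeSet : G.IsEdgeSet F
  isAcyclic : (toGraph F).IsAcyclic
  spanning : ∀ u, component F u = component G.E u ∨ (component F u).Infinite

theorem IsSpanningSubforest.of_reachable {F : Set (J × J)} (hF : G.IsEdgeSet F)
    (ha : (toGraph F).IsAcyclic)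
    (hr : (toGraph F).Reachable = (toGraph G.E).Reachable) : G.IsSpanningSubforest F where
  isEdgeSet := hF
  isAcyclic := ha
  spanning u := Or.inl <| by
    ext v
    simp only [component, SimpleGraph.ConnectedComponent.mem_supp_iff,
      SimpleGraph.ConnectedComponent.eq, hr]

end Graphing

end GraphingMatroid

end

/-!
The value `α(X)` is `½ ∫ deg_{X ∩ F} dμ`, half the average degree of the forest `X ∩ F`.

For a Borel forest `Y` with finite components, half the average degree equals `1 - ∫ 1 / |Y_u|`
(`half_avgDeg_add_lintegral_eq_one`). Within one component this is the count of `n - 1` edges in a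
tree with `n` nodes. To integrate it, let `b(u, v)` be the number of nodes behind the edge `uv` as
seen from `u`, and let `u` send `b(u, v) / n` to each neighbour `v`. The branches at `u` have `n - 1`
nodes in total, so `u` sends `(n - 1) / n`; the two branches at an edge have `n` nodes in total, so
what is sent and what is received along an edge add up to `1`. Since the edge measure is invariant
under swapping, mass transport is needed along edges only, never along the component relation. The
function `b` is Borel because the truncated branch sizes satisfy a recursion over the neighbour
kernel (`branchSize`).

Upper bound (`half_preEdgeMeasure_inter_le_rank`): by hyperfiniteness, `X ∩ F` becomes a forest with
finite components after deleting few edges, the identity above applies to what is left, and the rank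
is monotone.

Lower bound (`rank_le_half_preEdgeMeasure`): choosing deleted sets `Z n` with summable measures, the
forests `Y n = F \ ⋃ m ≥ n, Z m` have finite components and increase to `F` up to a null set of edges
(Borel–Cantelli). Since saturations of null sets are null (`ae_forall_component`), almost every
component of `F` is the increasing union of the components of the `Y n`, so the identity for `Y n`
passes to the limit. Finally `F` and `E` have the same rank because `F` is spanning.
-/

namespace GraphingMatroid

open ProbabilityTheory Filter Topology

/-! ### Branches of a forest -/

section Branch

variable {V : Type*} {g : SimpleGraph V}

/-- The branch at `u` in the direction of a neighbour `v`, truncated at depth `k`: the nodes reached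
from `v` by a path that avoids `u` and has fewer than `k` edges. With `k = ⊤` it is the whole
branch, and allowing `⊤` lets the truncated and the whole branches satisfy one recursion. -/
def branch (g : SimpleGraph V) (k : ℕ∞) (u v : V) : Set V :=
  {w | ∃ p : g.Walk v w, p.IsPath ∧ u ∉ p.support ∧ (p.length : ℕ∞) < k}

theorem branch_mono (u v : V) : Monotone fun k => branch g k u v :=
  fun _ _ hkl _ ⟨p, hp, hu, hk⟩ => ⟨p, hp, hu, hk.trans_le hkl⟩

theorem branch_zero (u v : V) : branch g 0 u v = ∅ := by
  ext w
  simp [branch]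

theorem branch_top_eq_iUnion (u v : V) : branch g ⊤ u v = ⋃ k : ℕ, branch g k u v := by
  refine subset_antisymm ?_ (iUnion_subset fun k => branch_mono u v le_top)
  rintro w ⟨p, hp, hu, -⟩
  exact mem_iUnion.2 ⟨p.length + 1, p, hp, hu, by exact_mod_cast p.length.lt_succ_self⟩

theorem notMem_branch (k : ℕ∞) (u v : V) : u ∉ branch g k u v :=
  fun ⟨p, _, hu, _⟩ => hu p.end_mem_support

theorem branch_subset_supp {k : ℕ∞} {u v : V} (h : g.Adj u v) :
    branch g k u v ⊆ (g.connectedComponentMk u).supp := by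
  rintro w ⟨p, -, -, -⟩
  rw [SimpleGraph.ConnectedComponent.mem_supp_iff, SimpleGraph.ConnectedComponent.eq]
  exact (h.reachable.trans p.reachable).symm

/-- Distinct branches at a node of a forest are disjoint. -/
theorem eq_of_mem_branch (hg : g.IsAcyclic) {k l : ℕ∞} {u v w x : V} (hv : g.Adj u v)
    (hw : g.Adj u w) (hxv : x ∈ branch g k u v) (hxw : x ∈ branch g l u w) : v = w := by
  obtain ⟨p, hp, hup, -⟩ := hxv
  obtain ⟨q, hq, huq, -⟩ := hxw
  have h := (hg.subsingleton_path u x).elim ⟨.cons hv p, hp.cons hup⟩ ⟨.cons hw q, hq.cons huq⟩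
  have h' := congrArg (fun r : g.Path u x => r.1.snd) h
  simpa using h'

/-- A branch of a forest consists of its first node `v` and the branches at `v` in the directions
other than the one leading back. -/
theorem branch_succ (hg : g.IsAcyclic) {u v : V} (h : g.Adj u v) (k : ℕ∞) :
    branch g (k + 1) u v = insert v (⋃ w ∈ {w | g.Adj v w ∧ w ≠ u}, branch g k v w) := by
  classical
  ext x
  simp only [mem_insert_iff, mem_iUnion, mem_ofPred_eq, exists_prop]
  constructor
  · rintro ⟨p, hp, hu, hk⟩
    cases p with
    | nil => exact Or.inl rfl
    | @cons _ w _ hvw q =>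
      rw [SimpleGraph.Walk.cons_isPath_iff] at hp
      simp only [SimpleGraph.Walk.support_cons, List.mem_cons, not_or] at hu
      refine Or.inr ⟨w, ⟨hvw, ?_⟩, q, hp.1, hp.2, ?_⟩
      · rintro rfl
        exact hu.2 q.start_mem_support
      · rw [SimpleGraph.Walk.length_cons, Nat.cast_add, Nat.cast_one] at hk
        exact lt_of_add_lt_add_right hk
  · rintro (rfl | ⟨w, ⟨hvw, hwu⟩, q, hq, hvq, hk⟩)
    · exact ⟨.nil, by simp, by simpa using h.ne, by simp⟩
    · refine ⟨.cons hvw q, hq.cons hvq, ?_, ?_⟩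
      · simp only [SimpleGraph.Walk.support_cons, List.mem_cons, not_or]
        refine ⟨h.ne, fun huq => hwu ?_⟩
        -- In a forest, a path from `v` that meets the neighbour `u` of `v` starts with the edge `vu`.
        simpa using (hg.eq_snd_of_adj_start (hq.cons (h := hvw) hvq) h.symm
          (List.mem_cons_of_mem _ huq)).symm
      · rw [SimpleGraph.Walk.length_cons, Nat.cast_add, Nat.cast_one]
        exact (ENat.add_lt_add_iff_right ENat.one_ne_top).2 hk

theorem supp_eq_insert_branch (u : V) : (g.connectedComponentMk u).supp =
    insert u (⋃ w ∈ {w | g.Adj u w}, branch g ⊤ u w) := by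
  classical
  refine subset_antisymm (fun x hx => ?_) (insert_subset (by simp) ?_)
  · rw [SimpleGraph.ConnectedComponent.mem_supp_iff, SimpleGraph.ConnectedComponent.eq] at hx
    obtain ⟨p, hp⟩ := hx.symm.exists_isPath
    cases p with
    | nil => exact mem_insert _ _
    | @cons _ w _ h q =>
      rw [SimpleGraph.Walk.cons_isPath_iff] at hp
      exact mem_insert_of_mem _ (mem_biUnion h ⟨q, hp.1, hp.2, WithTop.coe_lt_top _⟩)
  · exact iUnion₂_subset fun w hw => branch_subset_supp hw

/-- An edge of a forest splits its component into the two branches at its endpoints. -/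
theorem supp_eq_branch_union (hg : g.IsAcyclic) {u v : V} (h : g.Adj u v) :
    (g.connectedComponentMk u).supp = branch g ⊤ u v ∪ branch g ⊤ v u := by
  rw [supp_eq_insert_branch, ← top_add (1 : ℕ∞), branch_succ hg h.symm, top_add]
  have hs : {w | g.Adj u w} = insert v {w | g.Adj u w ∧ w ≠ v} := by
    ext w
    by_cases hw : w = v <;> simp [hw, h]
  rw [hs, biUnion_insert, union_insert]

theorem disjoint_branch (hg : g.IsAcyclic) {u v : V} (h : g.Adj u v) :
    Disjoint (branch g ⊤ u v) (branch g ⊤ v u) := by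
  rw [Set.disjoint_left]
  intro x hx hx'
  rw [← top_add (1 : ℕ∞), branch_succ hg h.symm] at hx'
  rcases hx' with rfl | hx'
  · exact notMem_branch _ _ _ hx
  · obtain ⟨w, ⟨hw, hwv⟩, hxw⟩ := mem_iUnion₂.1 hx'
    exact hwv (eq_of_mem_branch hg hw h hxw hx)

theorem encard_supp_eq_add (hg : g.IsAcyclic) {u v : V} (h : g.Adj u v) :
    (g.connectedComponentMk u).supp.encard = (branch g ⊤ u v).encard + (branch g ⊤ v u).encard := by
  rw [supp_eq_branch_union hg h, encard_union_eq (disjoint_branch hg h)]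

end Branch

/-! ### Cardinalities of disjoint and increasing unions -/

/-- With the full σ-algebra, cardinalities are values of a measure, so that countable additivity and
continuity from below become available for arbitrary sets. -/
theorem toENNReal_encard_eq_count {V : Type*} (s : Set V) :
    (s.encard : ℝ≥0∞) = @Measure.count V ⊤ s :=
  letI : MeasurableSpace V := ⊤
  (Measure.count_apply MeasurableSpace.measurableSet_top).symm

theorem toENNReal_encard_biUnion {V W : Type*} {s : Set W} (hs : s.Countable) {f : W → Set V}
    (hd : s.PairwiseDisjoint f) :
    (((⋃ w ∈ s, f w).encard : ℕ∞) : ℝ≥0∞) = ∑' w : s, ((f w).encard : ℝ≥0∞) := by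
  let _ : MeasurableSpace V := ⊤
  simp only [toENNReal_encard_eq_count]
  exact measure_biUnion hs hd fun _ _ => MeasurableSpace.measurableSet_top

theorem toENNReal_encard_iUnion {V : Type*} {f : ℕ → Set V} (hf : Monotone f) :
    (((⋃ n, f n).encard : ℕ∞) : ℝ≥0∞) = ⨆ n, ((f n).encard : ℝ≥0∞) := by
  let _ : MeasurableSpace V := ⊤
  simp only [toENNReal_encard_eq_count]
  exact hf.measure_iUnion

theorem toENNReal_encard_insert_biUnion_branch {V : Type*} {g : SimpleGraph V} (hg : g.IsAcyclic)
    (u : V) {s : Set V} (hs : s.Countable) (hsu : ∀ w ∈ s, g.Adj u w) (k : ℕ∞) :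
    (((insert u (⋃ w ∈ s, branch g k u w)).encard : ℕ∞) : ℝ≥0∞) =
      1 + ∑' w : s, ((branch g k u w).encard : ℝ≥0∞) := by
  have hd : s.PairwiseDisjoint fun w => branch g k u w := fun v hv w hw hvw =>
    Set.disjoint_left.2 fun x hxv hxw => hvw (eq_of_mem_branch hg (hsu v hv) (hsu w hw) hxv hxw)
  rw [encard_insert_of_notMem, ENat.toENNReal_add, toENNReal_encard_biUnion hs hd, add_comm]
  · simp
  · simp [notMem_branch]

/-! ### Components of the graph of an edge set -/

theorem component_congr {J : Type*} {X : Set (J × J)} {u v : J} (h : (toGraph X).Reachable u v) :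
    component X u = component X v := by
  rw [component, component, SimpleGraph.ConnectedComponent.eq.2 h]

theorem toGraph_mono {J : Type*} {X Y : Set (J × J)} (h : X ⊆ Y) : toGraph X ≤ toGraph Y := by
  intro u v
  simp only [toGraph, SimpleGraph.fromRel_adj]
  exact fun huv => ⟨huv.1, huv.2.imp (@h _) (@h _)⟩

theorem component_mono {J : Type*} {X Y : Set (J × J)} (h : X ⊆ Y) (u : J) :
    component X u ⊆ component Y u := by
  intro v
  simp only [component, SimpleGraph.ConnectedComponent.mem_supp_iff,
    SimpleGraph.ConnectedComponent.eq]
  exact fun hv => hv.mono (toGraph_mono h)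

/-- Components of an increasing union are increasing unions of components. The edges in `N` are those
that the union misses, and they must not meet the component in question. -/
theorem component_eq_iUnion {J : Type*} {F N : Set (J × J)} {Y : ℕ → Set (J × J)}
    (hmono : Monotone Y) (hYF : ∀ n, Y n ⊆ F) (hF : F ⊆ (⋃ n, Y n) ∪ N)
    (hN : ∀ x y, (x, y) ∈ N → (y, x) ∈ N) {u : J}
    (hu : ∀ v ∈ component F u, ∀ w, (v, w) ∉ N) : component F u = ⋃ n, component (Y n) u := by
  refine subset_antisymm (fun v hv => ?_) (iUnion_subset fun n => component_mono (hYF n) u)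
  have key : ∀ {a b : J} (p : (toGraph F).Walk a b), a ∈ component F u →
      ∃ n, (toGraph (Y n)).Reachable a b := by
    intro a b p
    induction p with
    | nil => exact fun _ => ⟨0, .rfl⟩
    | @cons a c b h p ih =>
      intro ha
      have hc : c ∈ component F u := by
        simp only [component, SimpleGraph.ConnectedComponent.mem_supp_iff,
          SimpleGraph.ConnectedComponent.eq] at ha ⊢
        exact h.symm.reachable.trans ha
      obtain ⟨n, hn⟩ := ih hc
      have hadj := h
      simp only [toGraph, SimpleGraph.fromRel_adj] at hadj
      have : ∃ m, (toGraph (Y m)).Adj a c := by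
        simp only [toGraph, SimpleGraph.fromRel_adj]
        rcases hadj.2 with h' | h'
        · obtain ⟨m, hm⟩ := mem_iUnion.1 ((hF h').resolve_right (hu a ha c))
          exact ⟨m, hadj.1, Or.inl hm⟩
        · obtain ⟨m, hm⟩ := mem_iUnion.1 ((hF h').resolve_right fun h => hu a ha c (hN _ _ h))
          exact ⟨m, hadj.1, Or.inr hm⟩
      obtain ⟨m, hm⟩ := this
      exact ⟨max m n, (hm.reachable.mono (toGraph_mono (hmono (le_max_left m n)))).trans
        (hn.mono (toGraph_mono (hmono (le_max_right m n))))⟩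
  have hv' := hv
  simp only [component, SimpleGraph.ConnectedComponent.mem_supp_iff,
    SimpleGraph.ConnectedComponent.eq] at hv'
  obtain ⟨p⟩ := hv'.symm
  obtain ⟨n, hn⟩ := key p rfl
  refine mem_iUnion.2 ⟨n, ?_⟩
  simp only [component, SimpleGraph.ConnectedComponent.mem_supp_iff,
    SimpleGraph.ConnectedComponent.eq]
  exact hn.symm

/-! ### The neighbour kernel of a graphing -/

namespace Graphing

variable {J : Type*} [MeasurableSpace J] [StandardBorelSpace J] (G : Graphing J)

theorem toGraph_adj {u v : J} : (toGraph G.E).Adj u v ↔ (u, v) ∈ G.E := by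
  simp only [toGraph, SimpleGraph.fromRel_adj]
  refine ⟨fun h => h.2.elim id (G.symm _ _), fun h => ⟨?_, Or.inl h⟩⟩
  rintro rfl
  exact G.loopless _ h

theorem finite_section (u : J) : (Prod.mk u ⁻¹' G.E).Finite := by
  obtain ⟨D, hD⟩ := G.bounded
  exact finite_of_encard_le_coe (hD u)

theorem count_restrict_section_apply (u : J) {B : Set J} (hB : MeasurableSet B) :
    Measure.count.restrict (Prod.mk u ⁻¹' G.E) B = deg (univ ×ˢ B ∩ G.E) u := by
  rw [Measure.restrict_apply hB,
    Measure.count_apply (hB.inter (measurable_prodMk_left G.measurableSet_E)), deg]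
  congr 2
  ext y
  simp

/-- The kernel that sends a node to the counting measure on its neighbours, so that
`∫⁻ v, f v ∂G.nbhd u` is the sum of `f` over the neighbours of `u`. -/
noncomputable def nbhd : Kernel J J where
  toFun u := Measure.count.restrict (Prod.mk u ⁻¹' G.E)
  measurable' := by
    refine Measure.measurable_of_measurable_coe _ fun B hB => ?_
    simp only [G.count_restrict_section_apply _ hB]
    exact G.measurable_deg_inter (MeasurableSet.univ.prod hB)

theorem nbhd_apply (u : J) : G.nbhd u = Measure.count.restrict (Prod.mk u ⁻¹' G.E) := rfl

instance : IsFiniteKernel G.nbhd := by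
  obtain ⟨D, hD⟩ := G.bounded
  refine ⟨⟨D, ENNReal.natCast_lt_top D, fun u => ?_⟩⟩
  rw [nbhd_apply, G.count_restrict_section_apply u MeasurableSet.univ, univ_prod_univ, univ_inter]
  simpa [deg] using ENat.toENNReal_mono (hD u)

theorem lintegral_nbhd (f : J → ℝ≥0∞) (u : J) :
    ∫⁻ v, f v ∂G.nbhd u = ∑' v : Prod.mk u ⁻¹' G.E, f v := by
  rw [nbhd_apply, lintegral_countable _ (G.finite_section u).countable]
  simp

theorem lintegral_nbhd_one (u : J) : ∫⁻ _, 1 ∂G.nbhd u = deg G.E u := by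
  rw [lintegral_one, nbhd_apply, G.count_restrict_section_apply u MeasurableSet.univ,
    univ_prod_univ, univ_inter]

theorem lintegral_nbhd_congr {f f' : J → ℝ≥0∞} {u : J} (h : ∀ v, (u, v) ∈ G.E → f v = f' v) :
    ∫⁻ v, f v ∂G.nbhd u = ∫⁻ v, f' v ∂G.nbhd u := by
  rw [lintegral_nbhd, lintegral_nbhd]
  exact tsum_congr fun v => h v v.2

theorem lintegral_nbhd_indicator_ne (f : J → ℝ≥0∞) (u v : J) :
    ∫⁻ w, {w | w ≠ u}.indicator f w ∂G.nbhd v = ∑' w : {w | (v, w) ∈ G.E ∧ w ≠ u}, f w := by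
  rw [lintegral_nbhd, tsum_subtype (Prod.mk v ⁻¹' G.E) ({w | w ≠ u}.indicator f), tsum_subtype,
    indicator_indicator]
  rfl

theorem preEdgeMeasure_eq_compProd : G.preEdgeMeasure = G.μ ⊗ₘ G.nbhd := by
  have := G.isProbabilityMeasure
  ext X hX
  rw [G.preEdgeMeasure_apply hX, Measure.compProd_apply hX]
  refine lintegral_congr fun u => ?_
  rw [nbhd_apply, G.count_restrict_section_apply u (measurable_prodMk_left hX), deg, deg]
  congr 2
  ext y
  simp

theorem lintegral_preEdgeMeasure {f : J × J → ℝ≥0∞} (hf : Measurable f) :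
    ∫⁻ e, f e ∂G.preEdgeMeasure = ∫⁻ u, ∫⁻ v, f (u, v) ∂G.nbhd u ∂G.μ := by
  have := G.isProbabilityMeasure
  rw [preEdgeMeasure_eq_compProd, Measure.lintegral_compProd hf]

/-- The mass transport principle along edges. -/
theorem lintegral_lintegral_nbhd_swap {f : J × J → ℝ≥0∞} (hf : Measurable f) :
    ∫⁻ u, ∫⁻ v, f (v, u) ∂G.nbhd u ∂G.μ = ∫⁻ u, ∫⁻ v, f (u, v) ∂G.nbhd u ∂G.μ := by
  rw [← G.lintegral_preEdgeMeasure hf, ← G.preEdgeMeasure_swap, lintegral_map hf measurable_swap]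
  exact (G.lintegral_preEdgeMeasure (hf.comp measurable_swap)).symm

/-! ### Measurability of the sizes of branches and components of a forest -/

/-- A Borel function on pairs of nodes that equals the size of the branch truncated at depth `k` on
the edges of a forest; off the edge set its values have no meaning. -/
noncomputable def branchSize : ℕ → J × J → ℝ≥0∞
  | 0 => fun _ => 0
  | k + 1 => fun p => 1 + ∫⁻ w, {q : (J × J) × J | q.2 ≠ q.1.1}.indicator
      (fun q => branchSize k (q.1.2, q.2)) (p, w) ∂G.nbhd p.2

theorem measurable_branchSize (k : ℕ) : Measurable (G.branchSize k) := by
  induction k with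
  | zero => exact measurable_const
  | succ k ih =>
    have hs : MeasurableSet {q : (J × J) × J | q.2 ≠ q.1.1} :=
      (measurableSet_eq_fun (by fun_prop) (by fun_prop)).compl
    have h : Measurable ({q : (J × J) × J | q.2 ≠ q.1.1}.indicator
        fun q => G.branchSize k (q.1.2, q.2)) :=
      (ih.comp (by fun_prop : Measurable fun q : (J × J) × J => (q.1.2, q.2))).indicator hs
    exact measurable_const.add
      (h.lintegral_kernel_prod_right' (κ := G.nbhd.comap Prod.snd measurable_snd))

theorem branchSize_eq (hG : (toGraph G.E).IsAcyclic) (k : ℕ) {u v : J} (h : (u, v) ∈ G.E) :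
    G.branchSize k (u, v) = (branch (toGraph G.E) k u v).encard := by
  classical
  induction k generalizing u v with
  | zero => simp [branchSize, branch_zero]
  | succ k ih =>
    have hs : {w | (toGraph G.E).Adj v w ∧ w ≠ u} = {w | (v, w) ∈ G.E ∧ w ≠ u} := by
      simp only [toGraph_adj]
    rw [Nat.cast_add, Nat.cast_one, branch_succ hG (G.toGraph_adj.2 h), hs,
      toENNReal_encard_insert_biUnion_branch hG v
        ((G.finite_section v).countable.mono fun w hw => hw.1) fun w hw => G.toGraph_adj.2 hw.1]
    rw [branchSize, ← tsum_congr fun w : {w | (v, w) ∈ G.E ∧ w ≠ u} => ih w.2.1,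
      ← G.lintegral_nbhd_indicator_ne (fun w => G.branchSize k (v, w))]
    rfl

theorem iSup_branchSize_eq (hG : (toGraph G.E).IsAcyclic) {u v : J} (h : (u, v) ∈ G.E) :
    ⨆ k, G.branchSize k (u, v) = (branch (toGraph G.E) ⊤ u v).encard := by
  rw [branch_top_eq_iUnion,
    toENNReal_encard_iUnion fun k l hkl => branch_mono u v (by exact_mod_cast hkl)]
  exact iSup_congr fun k => G.branchSize_eq hG k h

theorem encard_component_eq (hG : (toGraph G.E).IsAcyclic) (u : J) :
    ((component G.E u).encard : ℝ≥0∞) = 1 + ∫⁻ v, ⨆ k, G.branchSize k (u, v) ∂G.nbhd u := by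
  have hs : {w | (toGraph G.E).Adj u w} = Prod.mk u ⁻¹' G.E := by
    ext w
    exact G.toGraph_adj
  rw [component, supp_eq_insert_branch, hs, toENNReal_encard_insert_biUnion_branch hG u
    (G.finite_section u).countable fun w hw => G.toGraph_adj.2 hw, lintegral_nbhd]
  congr 1
  exact tsum_congr fun v => (G.iSup_branchSize_eq hG v.2).symm

theorem measurable_encard_component (hG : (toGraph G.E).IsAcyclic) :
    Measurable fun u => ((component G.E u).encard : ℝ≥0∞) := by
  simp only [G.encard_component_eq hG]
  exact measurable_const.add
    (Measurable.lintegral_kernel_prod_right' (Measurable.iSup G.measurable_branchSize))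

/-! ### The average degree of a forest with finite components -/

/-- In a finite tree with `n` nodes the branches at a node have `n - 1` nodes in total, while the two
branches at an edge have `n` nodes in total. Hence sending `b / n` along each edge, where `b` is the
size of the branch behind it, and transporting mass, shows that half the average degree is the
average of `(n - 1) / n`. -/
theorem half_avgDeg_add_lintegral_eq_one (hG : (toGraph G.E).IsAcyclic)
    (hfin : ∀ u, (component G.E u).Finite) :
    G.avgDeg / 2 + ∫⁻ u, ((component G.E u).encard : ℝ≥0∞)⁻¹ ∂G.μ = 1 := by
  have := G.isProbabilityMeasure
  set n : J → ℝ≥0∞ := fun u => ((component G.E u).encard : ℝ≥0∞) with hn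
  set b : J × J → ℝ≥0∞ := fun e => ⨆ k, G.branchSize k e with hb
  have hbm : Measurable b := Measurable.iSup G.measurable_branchSize
  have hnm : Measurable n := G.measurable_encard_component hG
  have hn0 (u : J) : n u ≠ 0 := by
    simp only [hn, ne_eq, ENat.toENNReal_eq_zero, encard_eq_zero]
    exact Nonempty.ne_empty ⟨u, rfl⟩
  have hnt (u : J) : n u ≠ ∞ := by
    simpa [hn] using hfin u
  have hfm : Measurable fun e : J × J => b e * (n e.1)⁻¹ := by fun_prop
  set I := ∫⁻ u, ∫⁻ v, b (u, v) * (n u)⁻¹ ∂G.nbhd u ∂G.μ with hI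
  have h1 : I + ∫⁻ u, (n u)⁻¹ ∂G.μ = 1 := by
    rw [hI, ← lintegral_add_right _ (by fun_prop : Measurable fun u => (n u)⁻¹),
      ← measure_univ (μ := G.μ), ← lintegral_one]
    refine lintegral_congr fun u => ?_
    rw [lintegral_mul_const _ (by fun_prop), ← ENNReal.inv_mul_cancel (hn0 u) (hnt u)]
    conv_rhs => rw [mul_comm, show n u = _ from G.encard_component_eq hG u, add_mul, one_mul]
    rw [add_comm, ← G.encard_component_eq hG u]
  have h2 : I + I = G.avgDeg := by
    -- Along an edge the received amount `b (v, u) / n v` complements the sent amount to `1`.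
    have hswap : I = ∫⁻ u, ∫⁻ v, b (v, u) * (n v)⁻¹ ∂G.nbhd u ∂G.μ :=
      (G.lintegral_lintegral_nbhd_swap hfm).symm
    nth_rw 1 [hswap]
    rw [← lintegral_add_left, avgDeg]
    · refine lintegral_congr fun u => ?_
      rw [← lintegral_add_left (by fun_prop), ← lintegral_nbhd_one]
      refine G.lintegral_nbhd_congr fun v hv => ?_
      have hr : n v = n u := by
        simp only [hn, component_congr (G.toGraph_adj.2 hv).reachable]
      have hs : n u = b (u, v) + b (v, u) := by
        simp only [hn, hb, G.iSup_branchSize_eq hG hv, G.iSup_branchSize_eq hG (G.symm _ _ hv)]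
        rw [component, encard_supp_eq_add hG (G.toGraph_adj.2 hv), ENat.toENNReal_add]
      rw [hr, ← add_mul, add_comm, ← hs, ENNReal.mul_inv_cancel (hn0 u) (hnt u)]
    · exact Measurable.lintegral_kernel_prod_right'
        (f := fun e : J × J => b (e.2, e.1) * (n e.2)⁻¹) (by fun_prop)
  have h3 : G.avgDeg / 2 = I := by
    rw [← h2, ← two_mul, mul_comm, ENNReal.mul_div_cancel_right two_ne_zero ENNReal.ofNat_ne_top]
  rw [h3, h1]

/-! ### The rank function on hyperfinite forests -/

theorem rank_mono {X Y : Set (J × J)} (h : X ⊆ Y) : G.rank X ≤ G.rank Y :=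
  tsub_le_tsub_left (lintegral_mono fun u => ENNReal.inv_le_inv.2
    (ENat.toENNReal_mono (encard_le_encard (component_mono h u)))) 1

variable {G}

theorem IsEdgeSet.diff {X Z : Set (J × J)} (hX : G.IsEdgeSet X) (hZ : G.IsEdgeSet Z) :
    G.IsEdgeSet (X \ Z) where
  measurableSet := hX.measurableSet.diff hZ.measurableSet
  symm _ _ h := ⟨hX.symm _ _ h.1, fun h' => h.2 (hZ.symm _ _ h')⟩
  subset := sdiff_subset.trans hX.subset

theorem IsEdgeSet.inter {X Z : Set (J × J)} (hX : G.IsEdgeSet X) (hZ : G.IsEdgeSet Z) :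
    G.IsEdgeSet (X ∩ Z) where
  measurableSet := hX.measurableSet.inter hZ.measurableSet
  symm _ _ h := ⟨hX.symm _ _ h.1, hZ.symm _ _ h.2⟩
  subset := inter_subset_left.trans hX.subset

theorem IsEdgeSet.iUnion {ι : Type*} [Countable ι] {X : ι → Set (J × J)}
    (hX : ∀ i, G.IsEdgeSet (X i)) : G.IsEdgeSet (⋃ i, X i) where
  measurableSet := .iUnion fun i => (hX i).measurableSet
  symm x y h := by
    obtain ⟨i, hi⟩ := mem_iUnion.1 h
    exact mem_iUnion.2 ⟨i, (hX i).symm _ _ hi⟩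
  subset := iUnion_subset fun i => (hX i).subset

theorem IsEdgeSet.avgDeg_sub {X : Set (J × J)} (hX : G.IsEdgeSet X) :
    (G.sub X hX).avgDeg = G.preEdgeMeasure X := by
  rw [G.preEdgeMeasure_apply hX.measurableSet, inter_eq_left.2 hX.subset]
  rfl

theorem IsEdgeSet.half_preEdgeMeasure_add {Y : Set (J × J)} (hY : G.IsEdgeSet Y)
    (ha : (toGraph Y).IsAcyclic) (hfin : ∀ u, (component Y u).Finite) :
    G.preEdgeMeasure Y / 2 + ∫⁻ u, ((component Y u).encard : ℝ≥0∞)⁻¹ ∂G.μ = 1 := by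
  rw [← hY.avgDeg_sub]
  exact (G.sub Y hY).half_avgDeg_add_lintegral_eq_one ha hfin

/-- Hyperfiniteness in terms of the unnormalized edge measure of the ambient graphing. -/
theorem IsEdgeSet.exists_preEdgeMeasure_lt {F : Set (J × J)} (hF : G.IsEdgeSet F)
    (hyp : (G.sub F hF).IsHyperfinite) {ε : ℝ≥0∞} (hε : 0 < ε) :
    ∃ Z, G.IsEdgeSet Z ∧ G.preEdgeMeasure Z < ε ∧ ∀ u, (component (F \ Z) u).Finite := by
  have hpre {Z : Set (J × J)} (hZ : (G.sub F hF).IsEdgeSet Z) :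
      (G.sub F hF).preEdgeMeasure Z = G.preEdgeMeasure Z := by
    rw [preEdgeMeasure_apply _ hZ.measurableSet, preEdgeMeasure_apply _ hZ.measurableSet,
      inter_eq_left.2 hZ.subset, inter_eq_left.2 (hZ.subset.trans hF.subset)]
    rfl
  have hd := (G.sub F hF).avgDeg_ne_top
  obtain ⟨Z, hZ, hlt, hfin⟩ := hyp (ε / (G.sub F hF).avgDeg) (ENNReal.div_pos hε.ne' hd)
  refine ⟨Z, ⟨hZ.measurableSet, hZ.symm, hZ.subset.trans hF.subset⟩, ?_, hfin⟩
  rw [← hpre hZ]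
  by_cases h0 : (G.sub F hF).avgDeg = 0
  · -- The normalization degenerates here, but then the edge measure vanishes altogether.
    exact (measure_mono (subset_univ Z)).trans_lt (by rwa [preEdgeMeasure_univ, h0])
  · rw [edgeMeasure, Measure.smul_apply, smul_eq_mul, ENNReal.div_eq_inv_mul] at hlt
    exact (ENNReal.mul_lt_mul_iff_right (ENNReal.inv_ne_zero.2 hd) (ENNReal.inv_ne_top.2 h0)).1 hlt

/-- Deleting a set of edges of measure less than `ε` makes all components finite, which only
decreases the rank. -/
theorem IsEdgeSet.half_preEdgeMeasure_inter_le_rank {F X : Set (J × J)} (hF : G.IsEdgeSet F)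
    (ha : (toGraph F).IsAcyclic) (hyp : (G.sub F hF).IsHyperfinite) (hX : G.IsEdgeSet X) :
    G.preEdgeMeasure (X ∩ F) / 2 ≤ G.rank X := by
  refine ENNReal.le_of_forall_pos_le_add fun ε hε _ => ?_
  obtain ⟨Z, hZ, hlt, hfin⟩ := hF.exists_preEdgeMeasure_lt hyp (ENNReal.coe_pos.2 hε)
  have hsub : (X ∩ F) \ Z ⊆ F \ Z := sdiff_subset_sdiff_left inter_subset_right
  have h1 := ((hX.inter hF).diff hZ).half_preEdgeMeasure_add
    (ha.anti (toGraph_mono (hsub.trans sdiff_subset)))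
    fun u => (hfin u).subset (component_mono hsub u)
  have h2 : G.preEdgeMeasure ((X ∩ F) \ Z) / 2 ≤ G.rank X := by
    refine le_trans ?_ (G.rank_mono (sdiff_subset.trans inter_subset_left : (X ∩ F) \ Z ⊆ X))
    rw [rank, ← h1]
    exact (ENNReal.add_sub_cancel_right
      (ne_top_of_le_ne_top ENNReal.one_ne_top (h1 ▸ le_add_self))).ge
  calc G.preEdgeMeasure (X ∩ F) / 2
      ≤ (G.preEdgeMeasure ((X ∩ F) \ Z) + G.preEdgeMeasure Z) / 2 := by
        gcongr
        exact (measure_mono (subset_sdiff_union _ _)).trans (measure_union_le _ _)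
    _ = G.preEdgeMeasure ((X ∩ F) \ Z) / 2 + G.preEdgeMeasure Z / 2 := ENNReal.add_div
    _ ≤ G.rank X + ε := add_le_add h2 (ENNReal.half_le_self.trans hlt.le)

/-- The neighbours of a null set form a null set. -/
theorem ae_forall_adj {P : J → Prop} (hP : ∀ᵐ u ∂G.μ, P u) :
    ∀ᵐ u ∂G.μ, ∀ v, (u, v) ∈ G.E → P v := by
  have hA := measure_toMeasurable {u | ¬ P u} (μ := G.μ)
  rw [ae_iff.1 hP] at hA
  set A := toMeasurable G.μ {u | ¬ P u} with hAdef
  have hAm : MeasurableSet A := measurableSet_toMeasurable _ _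
  have hmeas : Measurable (deg (G.E ∩ univ ×ˢ A)) := by
    rw [inter_comm]
    exact G.measurable_deg_inter (MeasurableSet.univ.prod hAm)
  have h := G.preserving univ A MeasurableSet.univ hAm
  rw [setLIntegral_measure_zero A _ hA, setLIntegral_univ, lintegral_eq_zero_iff hmeas] at h
  filter_upwards [h] with u hu v huv
  by_contra hv
  have hu' : Prod.mk u ⁻¹' (G.E ∩ univ ×ˢ A) = ∅ := by simpa [deg] using hu
  exact (hu' ▸ (⟨huv, trivial, subset_toMeasurable _ _ hv⟩ :
    v ∈ Prod.mk u ⁻¹' (G.E ∩ univ ×ˢ A)) : v ∈ (∅ : Set J))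

/-- The saturation of a null set under the component relation is a null set. -/
theorem ae_forall_component {P : J → Prop} (hP : ∀ᵐ u ∂G.μ, P u) :
    ∀ᵐ u ∂G.μ, ∀ v ∈ component G.E u, P v := by
  have h : ∀ k : ℕ, ∀ᵐ u ∂G.μ, ∀ v, ∀ p : (toGraph G.E).Walk u v, p.length = k → P v := by
    intro k
    induction k with
    | zero =>
      filter_upwards [hP] with u hu v p hp
      exact SimpleGraph.Walk.eq_of_length_eq_zero hp ▸ hu
    | succ k ih =>
      filter_upwards [ae_forall_adj ih] with u hu v p hp
      cases p with
      | nil => simp at hp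
      | @cons _ w _ h q => exact hu w (G.toGraph_adj.1 h) v q (by simpa using hp)
  filter_upwards [ae_all_iff.2 h] with u hu v hv
  simp only [component, SimpleGraph.ConnectedComponent.mem_supp_iff,
    SimpleGraph.ConnectedComponent.eq] at hv
  obtain ⟨p⟩ := hv.symm
  exact hu _ v p rfl

/-- The rank of a hyperfinite forest is at most half its average degree. Such a forest `F` is,
up to a null set of edges, an increasing union of forests `Y n` with finite components; the sizes
of the components of `Y n` then increase to those of `F` almost everywhere. -/
theorem IsEdgeSet.rank_le_half_preEdgeMeasure {F : Set (J × J)} (hF : G.IsEdgeSet F)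
    (ha : (toGraph F).IsAcyclic) (hyp : (G.sub F hF).IsHyperfinite) :
    G.rank F ≤ G.preEdgeMeasure F / 2 := by
  have := G.isProbabilityMeasure
  obtain ⟨ε, hε, hsum⟩ := ENNReal.exists_pos_sum_of_countable' one_ne_zero ℕ
  choose Z hZ hlt hfin using fun n => hF.exists_preEdgeMeasure_lt hyp (hε n)
  -- `N` is the upper limit of the sets `Z m`, a null set by the Borel–Cantelli lemma.
  let U (n : ℕ) : Set (J × J) := ⋃ m : {m // n ≤ m}, Z m
  have hU (n : ℕ) : G.IsEdgeSet (U n) := .iUnion fun m => hZ m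
  let N : Set (J × J) := ⋂ n, U n
  have hNm : MeasurableSet N := .iInter fun n => (hU n).measurableSet
  have hN0 : G.preEdgeMeasure N = 0 := by
    have h := measure_limsup_atTop_eq_zero (μ := G.preEdgeMeasure) (s := Z)
      (ne_top_of_le_ne_top ENNReal.one_ne_top
        ((ENNReal.tsum_le_tsum fun n => (hlt n).le).trans hsum.le))
    refine measure_mono_null (fun e he => ?_) h
    rw [limsup_eq_iInf_iSup_of_nat]
    simp only [iInf_eq_iInter, iSup_eq_iUnion, mem_iInter, mem_iUnion]
    intro n
    obtain ⟨⟨m, hm⟩, hem⟩ := mem_iUnion.1 (mem_iInter.1 he n)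
    exact ⟨m, hm, hem⟩
  let Y (n : ℕ) : Set (J × J) := F \ U n
  have hY (n : ℕ) : G.IsEdgeSet (Y n) := hF.diff (hU n)
  have hYF (n : ℕ) : Y n ⊆ F := sdiff_subset
  have hYa (n : ℕ) : (toGraph (Y n)).IsAcyclic := ha.anti (toGraph_mono (hYF n))
  have hYfin (n : ℕ) (u : J) : (component (Y n) u).Finite :=
    (hfin n u).subset (component_mono
      (sdiff_subset_sdiff_right (subset_iUnion (fun m : {m // n ≤ m} => Z m) ⟨n, le_rfl⟩)) u)
  have hYmono : Monotone Y := fun k l hkl => sdiff_subset_sdiff_right <|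
    iUnion_subset fun m => subset_iUnion (fun m : {m // k ≤ m} => Z m) ⟨m, hkl.trans m.2⟩
  have hlim : ∀ᵐ u ∂G.μ, Tendsto (fun n => ((component (Y n) u).encard : ℝ≥0∞)⁻¹) atTop
      (𝓝 ((component F u).encard : ℝ≥0∞)⁻¹) := by
    rw [G.preEdgeMeasure_apply hNm, lintegral_eq_zero_iff (G.measurable_deg_inter hNm)] at hN0
    filter_upwards [ae_forall_component hN0] with u hu
    have hc := component_eq_iUnion (N := N) (u := u) hYmono hYF
      (fun e he => by
        by_cases hN : e ∈ N
        · exact Or.inr hN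
        · obtain ⟨n, hn⟩ := not_forall.1 (mt mem_iInter.2 hN)
          exact Or.inl (mem_iUnion.2 ⟨n, he, hn⟩))
      (fun x y h => mem_iInter.2 fun n => (hU n).symm _ _ (mem_iInter.1 h n))
      (fun v hv w hvw => by
        have h0 : Prod.mk v ⁻¹' (N ∩ G.E) = ∅ := by
          simpa [deg] using hu v (component_mono hF.subset u hv)
        have hmem : w ∈ Prod.mk v ⁻¹' (N ∩ G.E) := ⟨hvw, (hU 0).subset (mem_iInter.1 hvw 0)⟩
        simp [h0] at hmem)
    have hm : Monotone fun n => component (Y n) u := fun k l hkl => component_mono (hYmono hkl) u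
    rw [hc, toENNReal_encard_iUnion hm]
    exact (tendsto_atTop_iSup fun k l hkl =>
      ENat.toENNReal_mono (encard_le_encard (hm hkl))).inv
  have hint : Tendsto (fun n => ∫⁻ u, ((component (Y n) u).encard : ℝ≥0∞)⁻¹ ∂G.μ) atTop
      (𝓝 (∫⁻ u, ((component F u).encard : ℝ≥0∞)⁻¹ ∂G.μ)) := by
    refine tendsto_lintegral_of_dominated_convergence (fun _ => 1)
      (fun n => ((G.sub (Y n) (hY n)).measurable_encard_component (hYa n)).inv)
      (fun n => ae_of_all _ fun u => ?_) (by simp) hlim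
    rw [ENNReal.inv_le_one, ← ENat.toENNReal_one, ENat.toENNReal_le, one_le_encard_iff_nonempty]
    exact ⟨u, rfl⟩
  rw [rank, tsub_le_iff_right]
  refine ge_of_tendsto' (tendsto_const_nhds.add hint) fun n => ?_
  rw [← (hY n).half_preEdgeMeasure_add (hYa n) (hYfin n)]
  gcongr
  exact hYF n

theorem IsSpanningSubforest.rank_eq {F : Set (J × J)} (hF : G.IsSpanningSubforest F) :
    G.rank F = G.rank G.E := by
  rw [rank, rank]
  congr 1
  refine lintegral_congr fun u => ?_
  rcases hF.spanning u with h | h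
  · rw [h]
  · rw [h.encard_eq, (h.mono (component_mono hF.isEdgeSet.subset u)).encard_eq]

variable (G)

theorem avgDeg_half_mul_edgeMeasure (X : Set (J × J)) :
    G.avgDeg / 2 * G.edgeMeasure X = G.preEdgeMeasure X / 2 := by
  rw [edgeMeasure, Measure.smul_apply, smul_eq_mul]
  by_cases h0 : G.avgDeg = 0
  · have h : G.preEdgeMeasure X = 0 :=
      measure_mono_null (subset_univ X) (by rw [preEdgeMeasure_univ, h0])
    simp [h]
  · rw [ENNReal.div_eq_inv_mul, ENNReal.div_eq_inv_mul, mul_assoc,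
      ENNReal.mul_inv_cancel_left h0 G.avgDeg_ne_top]

end Graphing

end GraphingMatroid

theorem mainTheorem5 {J : Type*} [MeasurableSpace J] [StandardBorelSpace J]
    (G : GraphingMatroid.Graphing J) (F : Set (J × J))
    (hF : G.IsSpanningSubforest F)
    (hyp : (G.sub F hF.isEdgeSet).IsHyperfinite) :
    ∃ α : Measure (J × J),
      (∀ X, MeasurableSet X → X ⊆ G.E → α X = G.avgDeg / 2 * G.edgeMeasure (X ∩ F)) ∧
      (∀ X, G.IsEdgeSet X → α X ≤ G.rank X) ∧
      α G.E = G.rank G.E := by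
  have hα : ∀ X, MeasurableSet X → ((G.avgDeg / 2) • G.edgeMeasure.restrict F) X =
      G.avgDeg / 2 * G.edgeMeasure (X ∩ F) := fun X hX => by
    rw [Measure.smul_apply, smul_eq_mul, Measure.restrict_apply hX]
  have hle : ∀ X, G.IsEdgeSet X →
      ((G.avgDeg / 2) • G.edgeMeasure.restrict F) X ≤ G.rank X := fun X hX => by
    rw [hα X hX.measurableSet, G.avgDeg_half_mul_edgeMeasure]
    exact hF.isEdgeSet.half_preEdgeMeasure_inter_le_rank hF.isAcyclic hyp hX
  refine ⟨_, fun X hX _ => hα X hX, hle,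
    le_antisymm (hle _ ⟨G.measurableSet_E, G.symm, subset_rfl⟩) ?_⟩
  rw [hα _ G.measurableSet_E, G.avgDeg_half_mul_edgeMeasure, inter_eq_right.2 hF.isEdgeSet.subset,
    ← hF.rank_eq]
  exact hF.isEdgeSet.rank_le_half_preEdgeMeasure hF.isAcyclic hyp
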